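/- Let $X$ be a real normed vector space with closed unit ball $D_X$ and topological dual $X^*$, let $K\subset X$ be a closed convex cone (with $0\in K$), and put $K^+=\{x^*\in X^*\mid x^*(k)\ge 0\ \forall k\in K\}$. A set $A\subset X$ is called $K$-bounded if $A\subset \ell D_X+K$ for some $\ell\ge 0$, and dually $K$-bounded if $x^*(A)$ is bounded from below for every $x^*\in K^+$. For nonempty $A\subset X$ put $\tilde A=\operatorname{cl}\operatorname{conv}(A+K)$, and let $$\mathcal C_{K^+}(X)=\{\tilde A\mid A\subset X \text{ nonempty and dually } K\text{-bounded}\},$$ with the operations $\tilde A\oplus\tilde B=\widetilde{A+B}$ and $\lambda\odot\tilde A=\widetilde{\lambda A}$ for $\lambda\ge 0$. This is a commutative monoid with cancellation and neutral element $K$. Its Rådström space $\mathcal G_{K^+}(X)$ is the real vector space of the classes $\langle\tilde A,\tilde B\rangle$ of pairs of elements of $\mathcal C_{K^+}(X)$ for the equivalence relation $$(\tilde A,\tilde B)\sim(\tilde C,\tilde D)\iff\tilde A\oplus\tilde D=\tilde B\oplus\tilde C,$$ with $\langle\tilde A,\tilde B\rangle+\langle\tilde C,\tilde D\rangle=\langle\tilde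 A\oplus\tilde C,\tilde B\oplus\tilde D\rangle$, with $\lambda\langle\tilde A,\tilde B\rangle=\langle\lambda\odot\tilde A,\lambda\odot\tilde B\rangle$ for $\lambda\ge 0$, and with $\lambda\langle\tilde A,\tilde B\rangle=\langle(-\lambda)\odot\tilde B,(-\lambda)\odot\tilde A\rangle$ for $\lambda<0$. Its ordering cone is $$\mathcal K_{K^+}(X)=\{\langle\tilde A,\tilde B\rangle\in\mathcal G_{K^+}(X)\mid\tilde A\subset\tilde B\}.$$ Let $\tau_{\mathcal P}$ be the locally convex topology on $\mathcal G_{K^+}(X)$ generated by the seminorms $$p_{x^*}(\langle\tilde A,\tilde B\rangle)=|\inf x^*(\tilde A)-\inf x^*(\tilde B)|,\qquad x^*\in K^+.$$ (i) The cone $\mathcal K_{K^+}(X)$ is closed in $\tau_{\mathcal P}$. (ii) If $K$ is pointed (that is, $K\cap(-K)=\{0\}$) and there is a nonempty dually $K$-bounded subset of $X$ that is not $K$-bounded, then the interior of $\mathcal K_{K^+}(X)$ in $\tau_{\mathcal P}$ is empty. -/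

import Mathlib

open scoped Pointwise

namespace Radstrom

variable {X : Type*} [NormedAddCommGroup X] [NormedSpace ℝ X]

/-- The positive polar `K⁺` of `K` in the topological dual of `X`. -/
def polar (K : ProperCone ℝ X) : Set (StrongDual ℝ X) :=
  {f | ∀ x ∈ K, 0 ≤ f x}

/-- `A` is `K`-bounded: `A ⊆ ℓ D_X + K` for some `ℓ ≥ 0`, with `D_X` the closed unit ball. -/
def IsConeBounded (K : ProperCone ℝ X) (A : Set X) : Prop :=
  ∃ l : ℝ, 0 ≤ l ∧ A ⊆ l • Metric.closedBall (0 : X) 1 + (K : Set X)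

/-- `A` is dually `K`-bounded: `f(A)` is bounded from below for every `f ∈ K⁺`. -/
def IsDuallyBounded (K : ProperCone ℝ X) (A : Set X) : Prop :=
  ∀ f ∈ polar K, BddBelow (f '' A)

/-- `Ã = cl conv (A + K)`. -/
def hull (K : ProperCone ℝ X) (A : Set X) : Set X :=
  closure (convexHull ℝ (A + (K : Set X)))

/-- The nonempty `K`-bounded sets. -/
def coneBoundedSets (K : ProperCone ℝ X) : Set (Set X) :=
  {A | A.Nonempty ∧ IsConeBounded K A}

/-- The nonempty dually `K`-bounded sets. -/
def duallyBoundedSets (K : ProperCone ℝ X) : Set (Set X) :=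
  {A | A.Nonempty ∧ IsDuallyBounded K A}

/-- `C_G(X)`: the sets `Ã`, where `A` is nonempty and dually `K`-bounded but not `K`-bounded. -/
def goossensHulls (K : ProperCone ℝ X) : Set (Set X) :=
  hull K '' (duallyBoundedSets K \ coneBoundedSets K)

/-- `C_{K⁺}(X)`: the sets `Ã`, where `A` is nonempty and dually `K`-bounded. -/
def duallyBoundedHulls (K : ProperCone ℝ X) : Set (Set X) :=
  hull K '' duallyBoundedSets K

/-- `m_A(f) = inf f(A)`, to be used for `f ∈ K⁺` and nonempty dually `K`-bounded `A`, where
the infimum is finite. -/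
noncomputable def infOn (f : StrongDual ℝ X) (A : Set X) : ℝ := sInf (f '' A)

section lemmas

variable {K : ProperCone ℝ X} {A B S T : Set X}

theorem zero_mem_polar (K : ProperCone ℝ X) : (0 : StrongDual ℝ X) ∈ polar K :=
  fun _ _ => le_rfl

theorem subset_hull (K : ProperCone ℝ X) (A : Set X) : A ⊆ hull K A := fun a ha =>
  subset_closure (subset_convexHull ℝ _ ⟨a, ha, 0, K.zero_mem, add_zero a⟩)

theorem le_on_hull {f : StrongDual ℝ X} (hf : f ∈ polar K) {c : ℝ} (h : ∀ a ∈ A, c ≤ f a) :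
    ∀ x ∈ hull K A, c ≤ f x := by
  have hsub : hull K A ⊆ f ⁻¹' Set.Ici c := by
    refine closure_minimal (convexHull_min ?_ ?_) (isClosed_Ici.preimage f.continuous)
    · rintro _ ⟨a, ha, k, hk, rfl⟩
      have h1 := h a ha
      have h2 := hf k hk
      simp only [Set.mem_preimage, Set.mem_Ici, map_add]
      linarith
    · exact (convex_Ici c).linear_preimage f.toLinearMap
  exact fun x hx => hsub hx

theorem lowerBounds_hull {f : StrongDual ℝ X} (hf : f ∈ polar K) (A : Set X) :
    lowerBounds (f '' hull K A) = lowerBounds (f '' A) := by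
  apply Set.Subset.antisymm
  · exact lowerBounds_mono_set (Set.image_mono (subset_hull K A))
  · rintro c hc _ ⟨x, hx, rfl⟩
    exact le_on_hull hf (fun a ha => hc ⟨a, ha, rfl⟩) x hx

theorem hull_mem (h : A ∈ duallyBoundedSets K) : hull K A ∈ duallyBoundedSets K := by
  refine ⟨h.1.mono (subset_hull K A), fun f hf => ?_⟩
  unfold BddBelow
  rw [lowerBounds_hull hf]
  exact h.2 f hf

theorem mem_of_mem_hulls (h : S ∈ duallyBoundedHulls K) : S ∈ duallyBoundedSets K := by
  obtain ⟨A, hA, rfl⟩ := h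
  exact hull_mem hA

/-- `inf f(Ã) = inf f(A)` for `f ∈ K⁺`. -/
theorem infOn_hull {f : StrongDual ℝ X} (hf : f ∈ polar K) (hA : A ∈ duallyBoundedSets K) :
    infOn f (hull K A) = infOn f A := by
  have h := isGLB_csInf (hA.1.image f) (hA.2 f hf)
  rw [IsGLB, ← lowerBounds_hull hf] at h
  exact IsGLB.csInf_eq h ((hull_mem hA).1.image f)

theorem infOn_add {f : StrongDual ℝ X} (hf : f ∈ polar K) (hA : A ∈ duallyBoundedSets K)
    (hB : B ∈ duallyBoundedSets K) : infOn f (A + B) = infOn f A + infOn f B := by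
  unfold infOn
  rw [Set.image_add, csInf_add (hA.1.image f) (hA.2 f hf) (hB.1.image f) (hB.2 f hf)]

theorem infOn_smul (f : StrongDual ℝ X) {c : ℝ} (hc : 0 ≤ c) (A : Set X) :
    infOn f (c • A) = c * infOn f A := by
  unfold infOn
  rw [Set.image_smul_comm (f : X → ℝ) c A (fun x => map_smul f c x),
    Real.sInf_smul_of_nonneg hc, smul_eq_mul]

theorem add_mem (hA : A ∈ duallyBoundedSets K) (hB : B ∈ duallyBoundedSets K) :
    A + B ∈ duallyBoundedSets K := by
  refine ⟨hA.1.add hB.1, fun f hf => ?_⟩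
  rw [Set.image_add]
  exact (hA.2 f hf).add (hB.2 f hf)

theorem smul_mem {c : ℝ} (hc : 0 ≤ c) (hA : A ∈ duallyBoundedSets K) :
    c • A ∈ duallyBoundedSets K := by
  refine ⟨hA.1.smul_set, fun f hf => ?_⟩
  rw [Set.image_smul_comm (f : X → ℝ) c A (fun x => map_smul f c x)]
  exact (hA.2 f hf).smul_of_nonneg hc

theorem singleton_zero_mem (K : ProperCone ℝ X) : ({0} : Set X) ∈ duallyBoundedSets K :=
  ⟨Set.singleton_nonempty 0, fun f _ => by simp⟩

theorem exists_polar_lt (hB : B.Nonempty) {x : X} (hx : x ∉ hull K B) :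
    ∃ f ∈ polar K, ∃ u : ℝ, f x < u ∧ ∀ b ∈ B, u ≤ f b := by
  obtain ⟨f, u, hxu, hu⟩ := geometric_hahn_banach_point_closed
    (convex_convexHull ℝ (B + (K : Set X))).closure isClosed_closure hx
  refine ⟨f, fun k hk => ?_, u, hxu, fun b hb => (hu b (subset_hull K B hb)).le⟩
  by_contra! hneg
  obtain ⟨b, hb⟩ := hB
  obtain ⟨n, hn⟩ := exists_nat_gt ((f b - u) / (-f k))
  have hmem : b + (n : ℝ) • k ∈ hull K B :=
    subset_closure (subset_convexHull ℝ _ ⟨b, hb, _, K.smul_mem hk n.cast_nonneg, rfl⟩)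
  have h1 := hu _ hmem
  rw [div_lt_iff₀ (by linarith)] at hn
  simp only [map_add, map_smul, smul_eq_mul] at h1
  linarith

theorem hulls_subset (hS : S ∈ duallyBoundedHulls K) (hT : T ∈ duallyBoundedHulls K)
    (h : ∀ f ∈ polar K, infOn f T ≤ infOn f S) : S ⊆ T := by
  have hS' := mem_of_mem_hulls hS
  obtain ⟨B, hB, rfl⟩ := hT
  intro x hxS
  by_contra hx
  obtain ⟨f, hf, u, hxu, hu⟩ := exists_polar_lt hB.1 hx
  have h1 : u ≤ infOn f B := le_csInf (hB.1.image f) (by rintro _ ⟨b, hb, rfl⟩; exact hu b hb)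
  have h2 : infOn f S ≤ f x := csInf_le (hS'.2 f hf) ⟨x, hxS, rfl⟩
  have h3 := h f hf
  rw [infOn_hull hf hB] at h3
  linarith

theorem hulls_ext (hS : S ∈ duallyBoundedHulls K) (hT : T ∈ duallyBoundedHulls K)
    (h : ∀ f ∈ polar K, infOn f S = infOn f T) : S = T :=
  (hulls_subset hS hT fun f hf => (h f hf).ge).antisymm
    (hulls_subset hT hS fun f hf => (h f hf).le)

/-- The neutral element is `K` itself. -/
theorem hull_singleton_zero (K : ProperCone ℝ X) : hull K {0} = (K : Set X) := by
  rw [hull, Set.singleton_add]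
  simp only [zero_add, Set.image_id']
  rw [K.convex.convexHull_eq, K.isClosed.closure_eq]

end lemmas

/-- The type of the elements `Ã` of `C_{K⁺}(X)`. -/
def HullSet (K : ProperCone ℝ X) : Type _ := {S : Set X // S ∈ duallyBoundedHulls K}

namespace HullSet

variable {K : ProperCone ℝ X}

/-- The element `Ã` for a nonempty dually `K`-bounded set `A`. -/
def mk (A : Set X) (hA : A ∈ duallyBoundedSets K) : HullSet K := ⟨hull K A, A, hA, rfl⟩

theorem mem (S : HullSet K) : S.1 ∈ duallyBoundedSets K := mem_of_mem_hulls S.2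

/-- `S ⊕ T` is the hull of `S + T`. -/
def add (S T : HullSet K) : HullSet K := mk (S.1 + T.1) (add_mem S.mem T.mem)

/-- `c ⊙ S` is the hull of `c S`, for `c ≥ 0`. -/
def smul (c : NNReal) (S : HullSet K) : HullSet K :=
  mk ((c : ℝ) • S.1) (smul_mem c.2 S.mem)

/-- The neutral element `K`, the hull of `{0}`. -/
def zero (K : ProperCone ℝ X) : HullSet K := mk {0} (singleton_zero_mem K)

theorem infOn_add {f : StrongDual ℝ X} (hf : f ∈ polar K) (S T : HullSet K) :
    infOn f (S.add T).1 = infOn f S.1 + infOn f T.1 :=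
  (infOn_hull hf (add_mem S.mem T.mem)).trans (Radstrom.infOn_add hf S.mem T.mem)

theorem infOn_smul {f : StrongDual ℝ X} (hf : f ∈ polar K) (c : NNReal) (S : HullSet K) :
    infOn f (S.smul c).1 = c * infOn f S.1 :=
  (infOn_hull hf (smul_mem c.2 S.mem)).trans (Radstrom.infOn_smul f c.2 S.1)

theorem ext_infOn {S T : HullSet K} (h : ∀ f ∈ polar K, infOn f S.1 = infOn f T.1) : S = T :=
  Subtype.ext (hulls_ext S.2 T.2 h)

/-- `Ã ⊕ B̃` is the hull of `A + B`. -/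
theorem mk_add_mk {A B : Set X} (hA : A ∈ duallyBoundedSets K) (hB : B ∈ duallyBoundedSets K) :
    (mk A hA).add (mk B hB) = mk (A + B) (add_mem hA hB) :=
  ext_infOn fun f hf => by
    rw [infOn_add hf]
    simp only [mk]
    rw [infOn_hull hf hA, infOn_hull hf hB, infOn_hull hf (add_mem hA hB),
      Radstrom.infOn_add hf hA hB]

/-- `c ⊙ Ã` is the hull of `c A`. -/
theorem smul_mk (c : NNReal) {A : Set X} (hA : A ∈ duallyBoundedSets K) :
    (mk A hA).smul c = mk ((c : ℝ) • A) (smul_mem c.2 hA) :=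
  ext_infOn fun f hf => by
    rw [infOn_smul hf]
    simp only [mk]
    rw [infOn_hull hf hA]
    exact ((infOn_hull hf (smul_mem c.2 hA)).trans (Radstrom.infOn_smul f c.2 A)).symm

end HullSet

/-- `(S, T) ∼ (S', T')` if and only if `S ⊕ T' = T ⊕ S'`. -/
def Rel (K : ProperCone ℝ X) (p q : HullSet K × HullSet K) : Prop :=
  p.1.add q.2 = p.2.add q.1

theorem rel_iff {K : ProperCone ℝ X} {p q : HullSet K × HullSet K} :
    Rel K p q ↔ ∀ f ∈ polar K,
      infOn f p.1.1 - infOn f p.2.1 = infOn f q.1.1 - infOn f q.2.1 := by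
  constructor
  · intro h f hf
    have h1 := congrArg (fun S : HullSet K => infOn f S.1) h
    simp only [HullSet.infOn_add hf] at h1
    linarith
  · intro h
    refine HullSet.ext_infOn fun f hf => ?_
    have h1 := h f hf
    simp only [HullSet.infOn_add hf]
    linarith

def setoid (K : ProperCone ℝ X) : Setoid (HullSet K × HullSet K) where
  r := Rel K
  iseqv :=
    { refl := fun _ => rel_iff.2 fun _ _ => rfl
      symm := fun h => rel_iff.2 fun f hf => (rel_iff.1 h f hf).symm
      trans := fun h h' => rel_iff.2 fun f hf => (rel_iff.1 h f hf).trans (rel_iff.1 h' f hf) }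

/-- The Rådström space `G_{K⁺}(X)` of `C_{K⁺}(X)`. -/
def Space (K : ProperCone ℝ X) : Type _ := Quotient (setoid K)

namespace Space

variable {K : ProperCone ℝ X}

/-- The class `⟨S, T⟩`. -/
def mk (S T : HullSet K) : Space K := Quotient.mk (setoid K) (S, T)

/-- `⟨S, T⟩ ↦ inf f(S) - inf f(T)`, for `f ∈ K⁺`. -/
noncomputable def gap (f : polar K) : Space K → ℝ :=
  Quotient.lift (fun p : HullSet K × HullSet K => infOn f.1 p.1.1 - infOn f.1 p.2.1)
    fun _ _ h => rel_iff.1 h f.1 f.2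

theorem gap_mk (f : polar K) (S T : HullSet K) :
    gap f (mk S T) = infOn f.1 S.1 - infOn f.1 T.1 := rfl

theorem ext_gap {g h : Space K} (H : ∀ f : polar K, gap f g = gap f h) : g = h := by
  induction g using Quotient.inductionOn with | _ p
  induction h using Quotient.inductionOn with | _ q
  exact Quotient.sound (rel_iff.2 fun f hf => H ⟨f, hf⟩)

instance : Zero (Space K) := ⟨mk (HullSet.zero K) (HullSet.zero K)⟩

/-- `⟨S, T⟩ + ⟨S', T'⟩ = ⟨S ⊕ S', T ⊕ T'⟩`. -/
instance : Add (Space K) :=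
  ⟨Quotient.map₂ (fun p q => (p.1.add q.1, p.2.add q.2)) fun p p' hp q q' hq =>
    rel_iff.2 fun f hf => by
      have h1 := rel_iff.1 hp f hf
      have h2 := rel_iff.1 hq f hf
      simp only [HullSet.infOn_add hf]
      linarith⟩

/-- `-⟨S, T⟩ = ⟨T, S⟩`. -/
instance : Neg (Space K) :=
  ⟨Quotient.map (fun p => (p.2, p.1)) fun p p' hp =>
    rel_iff.2 fun f hf => by
      have h1 := rel_iff.1 hp f hf
      simp only
      linarith⟩

/-- `c ⟨S, T⟩` is `⟨c ⊙ S, c ⊙ T⟩` for `c ≥ 0` and `⟨(-c) ⊙ T, (-c) ⊙ S⟩` for `c < 0`. -/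
noncomputable instance : SMul ℝ (Space K) :=
  ⟨fun c => Quotient.map
    (fun p => if 0 ≤ c then (p.1.smul c.toNNReal, p.2.smul c.toNNReal)
      else (p.2.smul (-c).toNNReal, p.1.smul (-c).toNNReal)) fun p p' hp =>
    rel_iff.2 fun f hf => by
      have h1 := rel_iff.1 hp f hf
      split_ifs
      · simp only [HullSet.infOn_smul hf, ← mul_sub, h1]
      · simp only [HullSet.infOn_smul hf, ← mul_sub]
        rw [← neg_sub (infOn f p.1.1), h1, neg_sub]⟩

theorem gap_zero (f : polar K) : gap f (0 : Space K) = 0 := sub_self _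

theorem gap_add (f : polar K) (g h : Space K) : gap f (g + h) = gap f g + gap f h := by
  induction g using Quotient.inductionOn with | _ p
  induction h using Quotient.inductionOn with | _ q
  change infOn f.1 (p.1.add q.1).1 - infOn f.1 (p.2.add q.2).1
    = (infOn f.1 p.1.1 - infOn f.1 p.2.1) + (infOn f.1 q.1.1 - infOn f.1 q.2.1)
  rw [HullSet.infOn_add f.2, HullSet.infOn_add f.2]
  ring

theorem gap_neg (f : polar K) (g : Space K) : gap f (-g) = -gap f g := by
  induction g using Quotient.inductionOn with | _ p
  exact (neg_sub _ _).symm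

theorem gap_smul (f : polar K) (c : ℝ) (g : Space K) : gap f (c • g) = c * gap f g := by
  induction g using Quotient.inductionOn with | _ p
  change gap f (Quotient.mk (setoid K) (if 0 ≤ c then (p.1.smul c.toNNReal, p.2.smul c.toNNReal)
      else (p.2.smul (-c).toNNReal, p.1.smul (-c).toNNReal))) = _
  split_ifs with hc
  · change infOn f.1 _ - infOn f.1 _ = c * (infOn f.1 p.1.1 - infOn f.1 p.2.1)
    rw [HullSet.infOn_smul f.2, HullSet.infOn_smul f.2, Real.coe_toNNReal c hc]
    ring
  · change infOn f.1 _ - infOn f.1 _ = c * (infOn f.1 p.1.1 - infOn f.1 p.2.1)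
    rw [HullSet.infOn_smul f.2, HullSet.infOn_smul f.2, Real.coe_toNNReal (-c) (by linarith)]
    ring

instance : AddCommGroup (Space K) where
  add_assoc a b c := ext_gap fun f => by simp only [gap_add]; ring
  zero_add a := ext_gap fun f => by simp only [gap_add, gap_zero]; ring
  add_zero a := ext_gap fun f => by simp only [gap_add, gap_zero]; ring
  add_comm a b := ext_gap fun f => by simp only [gap_add]; ring
  neg_add_cancel a := ext_gap fun f => by simp only [gap_add, gap_neg, gap_zero]; ring
  nsmul := nsmulRec
  zsmul := zsmulRec

noncomputable instance : Module ℝ (Space K) where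
  one_smul a := ext_gap fun f => by simp only [gap_smul]; ring
  mul_smul c d a := ext_gap fun f => by simp only [gap_smul]; ring
  smul_zero c := ext_gap fun f => by simp only [gap_smul, gap_zero]; ring
  smul_add c a b := ext_gap fun f => by simp only [gap_smul, gap_add]; ring
  add_smul c d a := ext_gap fun f => by simp only [gap_smul, gap_add]; ring
  zero_smul a := ext_gap fun f => by simp only [gap_smul, gap_zero]; ring

end Space

/-- The seminorm `⟨S, T⟩ ↦ |inf f(S) - inf f(T)|` on `G_{K⁺}(X)`, for `f ∈ K⁺`. -/
noncomputable def seminorms (K : ProperCone ℝ X) : SeminormFamily ℝ (Space K) (polar K) :=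
  fun f => Seminorm.of (fun g => |Space.gap f g|)
    (fun g h => by rw [Space.gap_add]; exact abs_add_le _ _)
    (fun c g => by rw [Space.gap_smul, abs_mul, Real.norm_eq_abs])

instance (K : ProperCone ℝ X) : Nonempty (polar K) := ⟨⟨0, zero_mem_polar K⟩⟩

/-- The locally convex topology `τ_P` on `G_{K⁺}(X)` generated by the seminorms above. -/
noncomputable instance (K : ProperCone ℝ X) : TopologicalSpace (Space K) :=
  (seminorms K).moduleFilterBasis.topology

theorem withSeminorms (K : ProperCone ℝ X) : WithSeminorms (seminorms K) := ⟨rfl⟩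

/-- The ordering cone `K_{K⁺}(X)`: the classes `⟨S, T⟩` with `S ⊆ T`. -/
def orderingCone (K : ProperCone ℝ X) : Set (Space K) :=
  {g | ∃ S T : HullSet K, g = Space.mk S T ∧ S.1 ⊆ T.1}

end Radstrom

open Filter Topology

namespace Radstrom

variable {X : Type*} [NormedAddCommGroup X] [NormedSpace ℝ X] {K : ProperCone ℝ X}

/-! ### The ordering cone is closed -/

/-! By Hahn–Banach, a hull is determined by its infima over `K⁺`, and inclusion of hulls reverses
the order of the infima. The ordering cone is therefore an intersection of half-spaces `0 ≤ gap f`,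
one for each `f ∈ K⁺`, and each `gap f` is continuous because its absolute value is a defining
seminorm.

For the interior, a basic neighbourhood controls only finitely many gaps. If some `g ≠ 0` has all of
these zero, the neighbourhood contains a whole line in the direction `g`, on which another gap takes
negative values. Such a `g` is a second difference of the hulls of `{0, v}`: the infimum `min 0 (f
v)` is affine in `v` off the hyperplane `f v = 0`, so the difference is seen only by functionals
whose kernel comes close to its base point. Two independent functionals in `K⁺` supply infinitely
many kernels, hence one that avoids any finite family (`exists_ne_zero_gap_eq_zero`). If no such
pair existed, pointedness would force `dim X ≤ 1`, where dually `K`-bounded sets are `K`-bounded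
(`exists_dual_pair`). -/

theorem orderingCone_eq (K : ProperCone ℝ X) :
    orderingCone K = {g | ∀ f : polar K, 0 ≤ Space.gap f g} := by
  ext g
  constructor
  · rintro ⟨S, T, rfl, hST⟩ f
    rw [Space.gap_mk, sub_nonneg]
    exact csInf_le_csInf (T.mem.2 f f.2) (S.mem.1.image _) (Set.image_mono hST)
  · intro hg
    induction g using Quotient.inductionOn with | _ p
    exact ⟨p.1, p.2, rfl, hulls_subset p.1.2 p.2.2 fun f hf => sub_nonneg.1 (hg ⟨f, hf⟩)⟩

/-- `Space.gap f` as a linear functional. -/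
noncomputable def gapLinear (f : polar K) : Space K →ₗ[ℝ] ℝ where
  toFun := Space.gap f
  map_add' := Space.gap_add f
  map_smul' := Space.gap_smul f

theorem seminorms_apply (f : polar K) (g : Space K) : seminorms K f g = |Space.gap f g| := rfl

theorem continuous_gap (f : polar K) : Continuous (Space.gap f) := by
  refine (withSeminorms K).continuous_normedSpace_rng ℝ (gapLinear f)
    ⟨{f}, 1, fun g => ?_⟩
  simp only [Finset.sup_singleton, one_smul]
  exact le_rfl

theorem isClosed_orderingCone (K : ProperCone ℝ X) : IsClosed (orderingCone K) := by
  rw [orderingCone_eq, Set.ofPred_forall]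
  exact isClosed_iInter fun f => isClosed_le continuous_const (continuous_gap f)

/-- If no finite family of gaps separates points, then the ordering cone has empty interior. -/
theorem interior_orderingCone_eq_empty
    (h : ∀ F : Finset (polar K), ∃ g : Space K, g ≠ 0 ∧ ∀ f ∈ F, Space.gap f g = 0) :
    interior (orderingCone K) = ∅ := by
  refine Set.eq_empty_of_forall_notMem fun g₀ hg₀ => ?_
  obtain ⟨F, r, hr, hF⟩ := (withSeminorms K).mem_nhds_iff g₀ _ |>.1
    (mem_interior_iff_mem_nhds.1 hg₀)
  obtain ⟨g, hg, hgF⟩ := h F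
  refine hg (Space.ext_gap fun f => ?_)
  rw [Space.gap_zero]
  by_contra hne
  -- The seminorms indexed by `F` vanish on `c • g`, so the entire line stays in the ball.
  have key : ∀ c : ℝ, 0 ≤ Space.gap f g₀ + c * Space.gap f g := fun c => by
    have hmem : g₀ + c • g ∈ orderingCone K := hF <| by
      rw [Seminorm.mem_ball, add_sub_cancel_left]
      refine Seminorm.finset_sup_apply_lt hr fun i hi => ?_
      rw [seminorms_apply, Space.gap_smul, hgF i hi]
      simpa using hr
    rw [orderingCone_eq] at hmem
    simpa only [Space.gap_add, Space.gap_smul] using hmem f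
  -- This multiple makes the gap equal to `-1`.
  have h1 := key (-(Space.gap f g₀ + 1) / Space.gap f g)
  rw [div_mul_cancel₀ _ hne] at h1
  linarith

/-! ### Second differences of hulls of two-point sets -/

theorem pair_mem (K : ProperCone ℝ X) (v : X) : ({0, v} : Set X) ∈ duallyBoundedSets K :=
  ⟨Set.insert_nonempty _ _, fun f _ => ((Set.toFinite {0, v}).image f).bddBelow⟩

/-- The hull of `{0, v}`. -/
def pairHull (K : ProperCone ℝ X) (v : X) : HullSet K := HullSet.mk {0, v} (pair_mem K v)

theorem infOn_pairHull {f : StrongDual ℝ X} (hf : f ∈ polar K) (v : X) :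
    infOn f (pairHull K v).1 = min 0 (f v) := by
  rw [pairHull, HullSet.mk, infOn_hull hf (pair_mem K v), infOn, Set.image_pair, csInf_pair,
    map_zero]

/-- The second difference of `v ↦ hull {0, v}` at `z` in the direction `w`. -/
def secondDifference (K : ProperCone ℝ X) (z w : X) : Space K :=
  Space.mk ((pairHull K (z + w)).add (pairHull K (z - w))) ((pairHull K z).add (pairHull K z))

theorem gap_secondDifference (f : polar K) (z w : X) :
    Space.gap f (secondDifference K z w) =
      min 0 (f.1 z + f.1 w) + min 0 (f.1 z - f.1 w) - (min 0 (f.1 z) + min 0 (f.1 z)) := by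
  simp only [secondDifference, Space.gap_mk, HullSet.infOn_add f.2, infOn_pairHull f.2, map_add,
    map_sub]

/-- The values of `f` at `z` and `z ± w` lie in one closed half-line, on which `min 0` is linear. -/
theorem gap_secondDifference_eq_zero {f : polar K} {z w : X} (h : |f.1 w| ≤ |f.1 z|) :
    Space.gap f (secondDifference K z w) = 0 := by
  rw [gap_secondDifference]
  rcases le_total 0 (f.1 z) with hz | hz
  · rw [abs_of_nonneg hz, abs_le] at h
    rw [min_eq_left (by linarith), min_eq_left (by linarith), min_eq_left hz]
    ring
  · rw [abs_of_nonpos hz, abs_le] at h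
    rw [min_eq_right (by linarith), min_eq_right (by linarith), min_eq_right hz]
    ring

/-- At the kink of `min 0` the second difference is `-|f w|`. -/
theorem secondDifference_ne_zero {f : polar K} {z w : X} (hz : f.1 z = 0) (hw : f.1 w ≠ 0) :
    secondDifference K z w ≠ 0 := by
  intro h
  have h1 := gap_secondDifference f z w
  rw [h, Space.gap_zero, hz] at h1
  rcases lt_or_gt_of_ne hw with hw | hw
  · rw [min_eq_right (by linarith), min_eq_left (by linarith), min_self] at h1
    linarith
  · rw [min_eq_left (by linarith), min_eq_right (by linarith), min_self] at h1
    linarith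

theorem exists_ne_zero_gap_eq_zero {f₁ f₂ : StrongDual ℝ X} (hf₁ : f₁ ∈ polar K)
    (hf₂ : f₂ ∈ polar K) {x₁ x₂ : X} (h₁₁ : f₁ x₁ = 1) (h₁₂ : f₁ x₂ = 0) (h₂₁ : f₂ x₁ = 0)
    (h₂₂ : f₂ x₂ = 1) (F : Finset (polar K)) :
    ∃ g : Space K, g ≠ 0 ∧ ∀ f ∈ F, Space.gap f g = 0 := by
  -- The point `x₂ - s • x₁` lies in the kernel of `f₁ + s • f₂`. Avoiding these ratios keeps it out
  -- of the kernel of every `f ∈ F` with `f x₁ ≠ 0`. When `f x₁ = 0`, the ratio is the default `0`,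
  -- whose exclusion is harmless: then `f` vanishes on the direction `δ • x₁`.
  obtain ⟨s, hs, hsF⟩ := (Set.Ici_infinite (0 : ℝ)).exists_notMem_finset
    (F.image fun f => f.1 x₂ / f.1 x₁)
  have hf₀ : f₁ + s • f₂ ∈ polar K := fun x hx =>
    add_nonneg (hf₁ x hx) (mul_nonneg hs (hf₂ x hx))
  have hsmall : ∀ᶠ δ : ℝ in 𝓝[>] 0, ∀ f ∈ F, |f.1 (δ • x₁)| ≤ |f.1 (x₂ - s • x₁)| := by
    rw [eventually_all_finset]
    intro f hf
    by_cases h0 : f.1 x₁ = 0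
    · exact Eventually.of_forall fun δ => by simp [h0]
    have hpos : 0 < |f.1 (x₂ - s • x₁)| := by
      rw [abs_pos, map_sub, map_smul, smul_eq_mul, sub_ne_zero]
      intro h
      exact hsF (Finset.mem_image.2 ⟨f, hf, by rw [h, mul_div_cancel_right₀ _ h0]⟩)
    have hlim : Tendsto (fun δ : ℝ => |f.1 (δ • x₁)|) (𝓝[>] 0) (𝓝 0) := by
      refine Tendsto.mono_left ?_ nhdsWithin_le_nhds
      have hc : Continuous fun δ : ℝ => |f.1 (δ • x₁)| := by fun_prop
      simpa using hc.tendsto 0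
    exact (hlim.eventually_lt_const hpos).mono fun _ h => h.le
  obtain ⟨δ, hδF, hδ⟩ := (hsmall.and self_mem_nhdsWithin).exists
  refine ⟨secondDifference K (x₂ - s • x₁) (δ • x₁),
    secondDifference_ne_zero (f := ⟨_, hf₀⟩) ?_ ?_, fun f hf =>
      gap_secondDifference_eq_zero (hδF f hf)⟩
  · simp [h₁₁, h₁₂, h₂₁, h₂₂]
  · simpa [h₁₁, h₂₁] using (Set.mem_Ioi.1 hδ).ne'

/-! ### Dual boundedness and boundedness for pointed cones on a line -/

theorem exists_polar_neg {x : X} (hx : x ∉ K) : ∃ f ∈ polar K, f x < 0 := by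
  obtain ⟨f, hf, u, hxu, hu⟩ := exists_polar_lt (K := K) (Set.singleton_nonempty 0) (x := x)
    (by rw [hull_singleton_zero]; exact hx)
  exact ⟨f, hf, hxu.trans_le (by simpa using hu 0 rfl)⟩

theorem eq_zero_of_polar_eq_zero (hK : (K : Set X) ∩ -(K : Set X) = {0}) {x : X}
    (hx : ∀ f ∈ polar K, f x = 0) : x = 0 := by
  have hmem : x ∈ (K : Set X) ∩ -(K : Set X) := by
    constructor
    · by_contra h
      obtain ⟨f, hf, hlt⟩ := exists_polar_neg h
      exact hlt.ne (hx f hf)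
    · by_contra h
      obtain ⟨f, hf, hlt⟩ := exists_polar_neg (K := K) (x := -x) h
      rw [map_neg, hx f hf] at hlt
      simp at hlt
  rwa [hK] at hmem

theorem isConeBounded_of_forall {A : Set X} {l : ℝ}
    (h : ∀ a ∈ A, ∃ b, ‖b‖ ≤ l ∧ a - b ∈ K) : IsConeBounded K A := by
  refine ⟨max l 0, le_max_right _ _, fun a ha => ?_⟩
  obtain ⟨b, hb, hab⟩ := h a ha
  refine ⟨b, ?_, a - b, hab, add_sub_cancel b a⟩
  rw [smul_unitClosedBall_of_nonneg (le_max_right _ _), mem_closedBall_zero_iff]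
  exact hb.trans (le_max_left _ _)

/-- Here `X` is the line spanned by `e`, so boundedness is a matter of the coordinate `f a`. -/
theorem IsDuallyBounded.isConeBounded_of_injective {A : Set X} (hA : IsDuallyBounded K A)
    {f : StrongDual ℝ X} (hf : f ∈ polar K) {e : X} (he : f e = 1)
    (hinj : ∀ x, f x = 0 → x = 0) : IsConeBounded K A := by
  have hrep : ∀ a, a = f a • e := fun a =>
    sub_eq_zero.1 (hinj _ (by simp [he]))
  obtain ⟨c, hc⟩ := hA f hf
  have hcA : ∀ a ∈ A, c ≤ f a := fun a ha => hc ⟨a, ha, rfl⟩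
  by_cases heK : e ∈ K
  · refine isConeBounded_of_forall (l := ‖c • e‖) fun a ha => ⟨c • e, le_rfl, ?_⟩
    rw [hrep a, ← sub_smul]
    exact K.smul_mem heK (sub_nonneg.2 (hcA a ha))
  -- As `g e < 0`, a lower bound for `g` on `A` is an upper bound for the coordinate, and `A` is
  -- norm bounded.
  · obtain ⟨g, hg, hge⟩ := exists_polar_neg heK
    obtain ⟨d, hd⟩ := hA g hg
    have hdA : ∀ a ∈ A, f a ≤ d / g e := fun a ha => by
      have h1 : d ≤ g a := hd ⟨a, ha, rfl⟩
      rw [hrep a, map_smul, smul_eq_mul] at h1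
      rwa [le_div_iff_of_neg hge]
    refine isConeBounded_of_forall (l := (|c| + |d / g e|) * ‖e‖) fun a ha =>
      ⟨a, ?_, by rw [sub_self]; exact K.zero_mem⟩
    rw [hrep a, norm_smul, Real.norm_eq_abs]
    refine mul_le_mul_of_nonneg_right (abs_le.2 ⟨?_, ?_⟩) (norm_nonneg e)
    · linarith [hcA a ha, neg_abs_le c, abs_nonneg (d / g e)]
    · linarith [hdA a ha, le_abs_self (d / g e), abs_nonneg c]

/-- If `K` is pointed and some dually `K`-bounded set is not `K`-bounded, then `K⁺` contains two
linearly independent functionals. -/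
theorem exists_dual_pair (hK : (K : Set X) ∩ -(K : Set X) = {0}) {A : Set X}
    (hA : IsDuallyBounded K A) (hA' : ¬ IsConeBounded K A) :
    ∃ f₁ ∈ polar K, ∃ f₂ ∈ polar K, ∃ x₁ x₂ : X,
      f₁ x₁ = 1 ∧ f₁ x₂ = 0 ∧ f₂ x₁ = 0 ∧ f₂ x₂ = 1 := by
  by_contra! H
  obtain ⟨f₁, hf₁, x, hx⟩ : ∃ f ∈ polar K, ∃ x, f x ≠ 0 := by
    by_contra! h0
    refine hA' (isConeBounded_of_forall (l := 0) fun a _ => ⟨0, norm_zero.le, ?_⟩)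
    rw [eq_zero_of_polar_eq_zero hK fun f hf => h0 f hf a, sub_zero]
    exact K.zero_mem
  have he : f₁ ((f₁ x)⁻¹ • x) = 1 := by simp [hx]
  refine hA' (hA.isConeBounded_of_injective hf₁ he fun y hy =>
    eq_zero_of_polar_eq_zero hK fun f₂ hf₂ => ?_)
  by_contra hne
  set e := (f₁ x)⁻¹ • x
  set x₂ := (f₂ y)⁻¹ • y
  have h₁ : f₁ x₂ = 0 := by simp [x₂, hy]
  have h₂ : f₂ x₂ = 1 := by simp [x₂, hne]
  -- Subtracting `f₂ e • x₂` kills `f₂` without changing `f₁`, since `f₁ x₂ = 0`.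
  exact H f₁ hf₁ f₂ hf₂ (e - f₂ e • x₂) x₂ (by simp [he, h₁]) h₁ (by simp [h₂]) h₂

end Radstrom

theorem proposition4p5 {X : Type*} [NormedAddCommGroup X] [NormedSpace ℝ X]
    (K : ProperCone ℝ X) :
    IsClosed (Radstrom.orderingCone K) ∧
    ((K : Set X) ∩ -(K : Set X) = {0} → (Radstrom.goossensHulls K).Nonempty →
      interior (Radstrom.orderingCone K) = ∅) := by
  refine ⟨Radstrom.isClosed_orderingCone K, fun hK hne => ?_⟩
  obtain ⟨_, A, ⟨hA, hA'⟩, rfl⟩ := hne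
  obtain ⟨f₁, hf₁, f₂, hf₂, x₁, x₂, h₁₁, h₁₂, h₂₁, h₂₂⟩ :=
    Radstrom.exists_dual_pair hK hA.2 fun h => hA' ⟨hA.1, h⟩
  exact Radstrom.interior_orderingCone_eq_empty
    (Radstrom.exists_ne_zero_gap_eq_zero hf₁ hf₂ h₁₁ h₁₂ h₂₁ h₂₂)
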